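/- Let $K$ be a commutative ring. Plane forests $F$ are drawn with roots at the top; the $|F|$ nodes are numbered in postorder, and $i<_Fj$ means that $i$ is a proper descendant of $j$. Let ${\mathcal H}_{NCK}$ be the noncommutative Connes–Kreimer algebra over $K$, with basis $Y_F$, product $Y_FY_G=Y_{FG}$ (concatenation) and coproduct $\Delta Y_F=\sum_u Y_{F_{(1)}}\otimes Y_{F_{(2)}}$, where $u$ runs over the words $u\in\{1,2\}^{|F|}$ such that $i<_Fj\Rightarrow u_i\le u_j$ and $F_{(c)}$ is the restriction of $F$ to the nodes labelled $c$. Let ${\mathcal H}_{NCK}^*$ be its (completed) dual, with the product dual to $\Delta$, and let $X_F$ be the dual basis of $Y_F$. Let ${\bf Sym}$ be the free associative algebra on $S_1,S_2,\ldots$ ($S_0=1$), let $\Lambda_n\in{\bf Sym}$ be defined by $\bigl(\sum_n(-1)^n\Lambda_n\bigr)\bigl(\sum_nS_n\bigr)=1$, and map ${\bf Sym}$ to ${\mathcal H}_{NCK}^*$ by the algebra morphism $S_n\mapsto\sum_{|F|=n}X_F$. For a composition $I=(i_1,\ldots,i_r)$ put $S^I=S_{i_1}\cdots S_{i_r}$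 and $\Lambda^I=\Lambda_{i_1}\cdots\Lambda_{i_r}$, and let $\langle Y_F,x\rangle$ be the coefficient of $X_F$ in the image of $x\in{\bf Sym}$. For an ordered alphabet $X=\{x_0<x_1<\cdots\}$ of commuting variables let $$\sigma_1(XA)=\prod_{x\in X}^{\rightarrow}\sum_{n\ge0}x^nS_n,\qquad \lambda_1(XA)=\prod_{x\in X}^{\rightarrow}\sum_{n\ge0}x^n\Lambda_n$$ (products in increasing order), and let $M_I(X)=\sum_{j_1<\cdots<j_r}x_{j_1}^{i_1}\cdots x_{j_r}^{i_r}$. Let $f(X)\mapsto f(-X)$ be the linear map on quasi-symmetric functions given by $M_I(-X)=(-1)^{\ell(I)}\sum_{J\le I}M_J(X)$, where $\ell(I)$ is the number of parts of $I$ and $J\le I$ means that $J$ is obtained from $I$ by adding up groups of consecutive parts. Finally let $\Gamma_F(A)=\sum_\sigma{\bf F}_\sigma(A)\in{\bf FQSym}$, where $\sigma$ runs over the linear extensions of $F$, i.e. the permutations with $i<_Fj\Rightarrow\sigma^{-1}(i)<\sigma^{-1}(j)$, and ${\bf F}_\sigma(A)$ is the sum of the words over an infinite ordered alphabet $A=\{a_0<a_1<\cdots\}$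 whose standardization is $\sigma^{-1}$; let $\Gamma_F(X)$ be its commutative image $a_i\mapsto x_i$. **Theorem.** For every plane forest $F$: 1. the coefficient of $X_F$ in $\sigma_1(XA)$ is $$\sum_I\langle Y_F,S^I\rangle M_I(X)=\Gamma_F(X);$$ 2. $\Gamma_F(X)$ is quasi-symmetric and the coefficient of $X_F$ in $\lambda_1(XA)$ is $$\sum_I\langle Y_F,\Lambda^I\rangle M_I(X)=(-1)^{|F|}\,\Gamma_F(-X)=:\chi_F(X).$$ Both sums run over all compositions $I$ and have only finitely many nonzero terms. -/

import Mathlib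

open scoped TensorProduct

/-- Plane forests (finite ordered sequences of plane rooted trees).  A forest is either empty, or it
is `B₊(F) · G`: a first tree whose root carries the forest `F` of subtrees, followed by the
forest `G` of the remaining trees. -/
inductive PlaneForest : Type
  | empty : PlaneForest
  | cons (F G : PlaneForest) : PlaneForest

namespace PlaneForest

/-- The degree `|F|`: the number of nodes. -/
def size : PlaneForest → ℕ
  | empty => 0
  | cons F G => F.size + 1 + G.size

/-- Concatenation of plane forests. -/
def concat : PlaneForest → PlaneForest → PlaneForest
  | empty, H => H
  | cons F G, H => cons F (concat G H)

instance : Monoid PlaneForest where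
  mul := concat
  one := empty
  one_mul _ := rfl
  mul_one F := by
    induction F with
    | empty => rfl
    | cons F G _ ih => exact congrArg (cons F) ih
  mul_assoc F G H := by
    induction F with
    | empty => rfl
    | cons F F' _ ih => exact congrArg (cons F) ih

/-- The nodes of `F` are numbered in postorder by `Fin F.size`: in `B₊(F) · G` the nodes
of `F` come first, then the root of the first tree, then the nodes of `G`.  This is the number of
a node of `F`. -/
def inSub (F G : PlaneForest) (i : Fin F.size) : Fin (cons F G).size :=
  Fin.castAdd G.size i.castSucc

/-- The root of the first tree of `B₊(F) · G`, as a node. -/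
def root (F G : PlaneForest) : Fin (cons F G).size := Fin.castAdd G.size (Fin.last F.size)

/-- A node of the rest `G` of `B₊(F) · G`. -/
def inRest (F G : PlaneForest) (j : Fin G.size) : Fin (cons F G).size :=
  Fin.natAdd (F.size + 1) j

/-- `F.IsBelow i j` is the strict order `i <_F j` of the poset whose Hasse diagram is `F` drawn with
the roots at the top: `i` is a proper descendant of `j`. -/
def IsBelow : (F : PlaneForest) → Fin F.size → Fin F.size → Prop
  | empty, _, _ => False
  | cons F G, i, j =>
      (∃ a b, F.IsBelow a b ∧ i = inSub F G a ∧ j = inSub F G b) ∨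
      (∃ a, i = inSub F G a ∧ j = root F G) ∨
      (∃ a b, G.IsBelow a b ∧ i = inRest F G a ∧ j = inRest F G b)

open Classical in
/-- The restriction of a plane forest to a set of nodes: the plane forest formed by these nodes,
with the induced descendant order and the induced left-to-right order. -/
noncomputable def restrict : (F : PlaneForest) → (Fin F.size → Prop) → PlaneForest
  | empty, _ => empty
  | cons F G, p =>
      if p (root F G) then
        cons (F.restrict fun i => p (inSub F G i)) (G.restrict fun j => p (inRest F G j))
      else
        (F.restrict fun i => p (inSub F G i)) * (G.restrict fun j => p (inRest F G j))

open Classical in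
/-- The words `u ∈ C(F) ∩ [r]^n` (`n = |F|`), i.e. those with `i <_F j ⇒ u_i ≤ u_j`.  The letters
`1, …, r` are represented by `Fin r`. -/
noncomputable def labellings (F : PlaneForest) (r : ℕ) : Finset (Fin F.size → Fin r) :=
  Finset.univ.filter fun u => ∀ i j, F.IsBelow i j → u i ≤ u j

/-- The restriction of `F` to the nodes with label `c`. -/
noncomputable def part {α : Type*} (F : PlaneForest) (u : Fin F.size → α) (c : α) : PlaneForest :=
  F.restrict fun i => u i = c

@[simp]
theorem labellings_empty (r : ℕ) : (empty).labellings r = Finset.univ := by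
  ext u; simp [labellings, IsBelow]

@[simp] theorem restrict_true (F : PlaneForest) : (F.restrict fun _ => True) = F := by
  induction F with
  | empty => rfl
  | cons F G h1 h2 => simp [restrict, h1, h2]

@[simp] theorem restrict_false (F : PlaneForest) : (F.restrict fun _ => False) = 1 := by
  induction F with
  | empty => rfl
  | cons F G h1 h2 => simp [restrict, h1, h2]

/-- The labelling of `B₊(F) · G` with prescribed labels on `F`, the root and `G`. -/
def glue {α : Type*} (F G : PlaneForest) (x : ((Fin F.size → α) × α) × (Fin G.size → α)) :
    Fin (cons F G).size → α :=
  Fin.append (Fin.snoc x.1.1 x.1.2 : Fin (F.size + 1) → α) x.2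

section
variable {α : Type*} (F G : PlaneForest) (x : ((Fin F.size → α) × α) × (Fin G.size → α))

@[simp] theorem glue_inSub (i) : glue F G x (inSub F G i) = x.1.1 i := by
  simp [glue, inSub]

@[simp] theorem glue_root : glue F G x (root F G) = x.1.2 := by
  simp [glue, root]

@[simp] theorem glue_inRest (i) : glue F G x (inRest F G i) = x.2 i := by
  simp [glue, inRest]

theorem glue_bijective : Function.Bijective (glue (α := α) F G) := by
  constructor
  · intro x y h
    ext i
    · simpa using congrFun h (inSub F G i)
    · simpa using congrFun h (root F G)
    · simpa using congrFun h (inRest F G i)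
  · intro u
    refine ⟨((fun i => u (inSub F G i), u (root F G)), fun j => u (inRest F G j)), ?_⟩
    funext k
    change Fin (F.size + 1 + G.size) at k
    induction k using Fin.addCases with
    | left k =>
      induction k using Fin.lastCases with
      | last => exact glue_root F G _
      | cast k => exact glue_inSub F G _ k
    | right k => exact glue_inRest F G _ k
end

theorem glue_mem_labellings {r : ℕ} (F G : PlaneForest)
    (x : ((Fin F.size → Fin r) × Fin r) × (Fin G.size → Fin r)) :
    glue F G x ∈ (cons F G).labellings r ↔
      (x.1.1 ∈ F.labellings r ∧ ∀ i, x.1.1 i ≤ x.1.2) ∧ x.2 ∈ G.labellings r := by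
  simp only [labellings, Finset.mem_filter, Finset.mem_univ, true_and]
  constructor
  · intro h
    refine ⟨⟨fun i j hij => ?_, fun i => ?_⟩, fun i j hij => ?_⟩
    · simpa using h (inSub F G i) (inSub F G j) (Or.inl ⟨i, j, hij, rfl, rfl⟩)
    · simpa using h (inSub F G i) (root F G) (Or.inr (Or.inl ⟨i, rfl, rfl⟩))
    · simpa using h (inRest F G i) (inRest F G j) (Or.inr (Or.inr ⟨i, j, hij, rfl, rfl⟩))
  · rintro ⟨⟨h1, h2⟩, h3⟩ i j (⟨a, b, h, rfl, rfl⟩ | ⟨a, rfl, rfl⟩ | ⟨a, b, h, rfl, rfl⟩)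
    · simpa using h1 a b h
    · simpa using h2 a
    · simpa using h3 a b h

end PlaneForest

/-- The underlying algebra of the noncommutative Connes-Kreimer algebra: the free module on the basis
`Y_F` (`F` a plane forest) with the concatenation product `Y_F Y_G = Y_{FG}`. -/
def HNCK (K : Type*) [CommRing K] : Type _ := MonoidAlgebra K PlaneForest

namespace HNCK

open PlaneForest

variable {K : Type*} [CommRing K]

noncomputable instance : Ring (HNCK K) := inferInstanceAs (Ring (MonoidAlgebra K PlaneForest))

noncomputable instance : Algebra K (HNCK K) :=
  inferInstanceAs (Algebra K (MonoidAlgebra K PlaneForest))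

/-- The basis `Y_F`. -/
noncomputable def basisY (K : Type*) [CommRing K] : Module.Basis PlaneForest K (HNCK K) :=
  MonoidAlgebra.basis PlaneForest K

/-- The basis element `Y_F`. -/
noncomputable abbrev Y (F : PlaneForest) : HNCK K := basisY K F

/-- The value of the coproduct on `Y_F`:
`Δ Y_F = ∑_{u ∈ C(F) ∩ [2]^n} Y_{F_(1)} ⊗ Y_{F_(2)}`. -/
noncomputable def coprodY (F : PlaneForest) : HNCK K ⊗[K] HNCK K :=
  ∑ u ∈ F.labellings 2, Y (F.part u 0) ⊗ₜ[K] Y (F.part u 1)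


theorem Y_mul (F G : PlaneForest) : (Y F * Y G : HNCK K) = Y (F * G) := by
  change (MonoidAlgebra.single F (1 : K) * MonoidAlgebra.single G (1 : K) : MonoidAlgebra K _) = _
  rw [MonoidAlgebra.single_mul_single, one_mul]
  rfl

theorem Y_one : (Y 1 : HNCK K) = 1 := rfl

/-- The operator `B₊`. -/
noncomputable def B : HNCK K →ₗ[K] HNCK K := (basisY K).constr K fun F => Y (cons F 1)

@[simp] theorem B_Y (F : PlaneForest) : B (Y F : HNCK K) = Y (cons F 1) :=
  (basisY K).constr_basis K _ F

theorem Y_cons (F G : PlaneForest) : (Y (cons F G) : HNCK K) = B (Y F) * Y G := by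
  rw [B_Y, Y_mul]; rfl

theorem coprodY_one : coprodY (K := K) 1 = 1 := by
  change ∑ u ∈ (empty).labellings 2, _ = _
  rw [labellings_empty]
  have : Unique (Fin empty.size → Fin 2) := inferInstanceAs (Unique (Fin 0 → Fin 2))
  rw [Fintype.sum_unique]
  rfl

theorem coprodY_cons (F G : PlaneForest) :
    coprodY (K := K) (cons F G) =
      (B (Y F) ⊗ₜ[K] 1 + B.lTensor (HNCK K) (coprodY F)) * coprodY G := by
  classical
  have key : coprodY (K := K) (cons F G) =
      ∑ c : Fin 2, ∑ uF ∈ (F.labellings 2).filter (fun u => ∀ i, u i ≤ c),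
        ∑ uG ∈ G.labellings 2,
          (Y ((cons F G).part (glue F G ((uF, c), uG)) 0) ⊗ₜ[K]
            Y ((cons F G).part (glue F G ((uF, c), uG)) 1) : HNCK K ⊗[K] HNCK K) := by
    have h1 : coprodY (K := K) (cons F G) =
        ∑ x ∈ (((F.labellings 2) ×ˢ (Finset.univ : Finset (Fin 2))).filter
            (fun y => ∀ i, y.1 i ≤ y.2)) ×ˢ (G.labellings 2),
          (Y ((cons F G).part (glue F G x) 0) ⊗ₜ[K]
            Y ((cons F G).part (glue F G x) 1) : HNCK K ⊗[K] HNCK K) := by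
      symm
      refine Finset.sum_bij (fun x _ => glue F G x) ?_ ?_ ?_ ?_
      · intro x hx
        rw [glue_mem_labellings]
        simpa using hx
      · intro x _ y _ h
        exact (glue_bijective F G).1 h
      · intro u hu
        obtain ⟨x, rfl⟩ := (glue_bijective F G).2 u
        rw [glue_mem_labellings] at hu
        exact ⟨x, by simpa using hu, rfl⟩
      · intro x _
        rfl
    rw [h1, Finset.sum_product, Finset.sum_filter, Finset.sum_product_right]
    refine Finset.sum_congr rfl fun c _ => ?_
    rw [Finset.sum_filter]
  have hpart : ∀ (x : ((Fin F.size → Fin 2) × Fin 2) × (Fin G.size → Fin 2)) (c : Fin 2),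
      (cons F G).part (glue F G x) c =
        if x.1.2 = c then cons (F.part x.1.1 c) (G.part x.2 c)
        else F.part x.1.1 c * G.part x.2 c := by
    intro x c
    simp [part, restrict]
  have h0 : (F.labellings 2).filter (fun u => ∀ i, u i ≤ 0) = {fun _ => 0} := by
    ext u
    simp only [labellings, Finset.mem_filter, Finset.mem_univ, true_and, Finset.mem_singleton,
      Fin.le_zero_iff]
    exact ⟨fun h => funext h.2, fun h => by subst h; simp⟩
  have h1 : (F.labellings 2).filter (fun u => ∀ i, u i ≤ 1) = F.labellings 2 := by
    refine Finset.filter_true_of_mem fun u _ i => ?_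
    exact Fin.le_last (u i)
  rw [key, Fin.sum_univ_two, h0, h1, Finset.sum_singleton, add_mul]
  congr 1
  · rw [coprodY, Finset.mul_sum]
    refine Finset.sum_congr rfl fun uG _ => ?_
    have e0 : F.part (fun _ => (0 : Fin 2)) 0 = F := by simp [part]
    have e1 : F.part (fun _ => (0 : Fin 2)) 1 = 1 := by simp [part]
    simp only [hpart, e0, e1]
    simp [Y_cons, -B_Y]
  · rw [coprodY, coprodY, map_sum, Finset.sum_mul_sum]
    refine Finset.sum_congr rfl fun uF _ => Finset.sum_congr rfl fun uG _ => ?_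
    simp only [hpart]
    simp [Y_cons, -B_Y, ← Y_mul]

theorem coprodY_mul (F G : PlaneForest) :
    coprodY (K := K) (F * G) = coprodY F * coprodY G := by
  induction F with
  | empty =>
    change coprodY (K := K) (1 * G) = coprodY 1 * coprodY G
    rw [coprodY_one, one_mul, one_mul]
  | cons F F' _ ih =>
    change coprodY (cons F (F' * G)) = _
    rw [coprodY_cons, coprodY_cons, ih, mul_assoc]

/-- The coproduct of admissible cuts and the counit (`1` on the empty forest, `0` on the others). -/
noncomputable instance : CoalgebraStruct K (HNCK K) where
  comul := (basisY K).constr K coprodY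
  counit := (basisY K).constr K fun F => match F with
    | empty => 1
    | cons _ _ => 0

open Coalgebra

theorem comul_Y (F : PlaneForest) : comul (R := K) (Y F : HNCK K) = coprodY F :=
  (basisY K).constr_basis K _ F

theorem counit_Y_one : counit (R := K) (Y 1 : HNCK K) = 1 :=
  (basisY K).constr_basis K _ 1

theorem counit_Y_cons (F G : PlaneForest) : counit (R := K) (Y (cons F G) : HNCK K) = 0 :=
  (basisY K).constr_basis K _ (cons F G)

/-- The coproduct is an algebra morphism. -/
noncomputable def comulHom : HNCK K →ₐ[K] HNCK K ⊗[K] HNCK K :=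
  AlgHom.ofLinearMap comul (by rw [← Y_one, comul_Y, coprodY_one]) <| by
    intro x y
    have h : (LinearMap.mul K (HNCK K)).compr₂ (comul (R := K) (A := HNCK K)) =
        (LinearMap.mul K (HNCK K ⊗[K] HNCK K)).compl₁₂ comul comul := by
      refine (basisY K).ext fun F => (basisY K).ext fun G => ?_
      simp only [LinearMap.compr₂_apply, LinearMap.mul_apply', LinearMap.compl₁₂_apply]
      rw [Y_mul, comul_Y, comul_Y, comul_Y, coprodY_mul]
    exact congrFun (congrArg DFunLike.coe (congrFun (congrArg DFunLike.coe h) x)) y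

@[simp] theorem comulHom_apply (x : HNCK K) : comulHom x = comul (R := K) x := rfl

/-- The counit is an algebra morphism. -/
noncomputable def counitHom : HNCK K →ₐ[K] K :=
  AlgHom.ofLinearMap counit (by rw [← Y_one, counit_Y_one]) <| by
    intro x y
    have h : (LinearMap.mul K (HNCK K)).compr₂ (counit (R := K) (A := HNCK K)) =
        (LinearMap.mul K K).compl₁₂ counit counit := by
      refine (basisY K).ext fun F => (basisY K).ext fun G => ?_
      simp only [LinearMap.compr₂_apply, LinearMap.mul_apply', LinearMap.compl₁₂_apply]
      rw [Y_mul]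
      cases F with
      | empty =>
        change counit (R := K) (Y (1 * G) : HNCK K) = counit (R := K) (Y 1 : HNCK K) * _
        rw [one_mul, counit_Y_one, one_mul]
      | cons F F' =>
        change counit (R := K) (Y (cons F (F' * G)) : HNCK K) = _
        rw [counit_Y_cons, counit_Y_cons, zero_mul]
    exact congrFun (congrArg DFunLike.coe (congrFun (congrArg DFunLike.coe h) x)) y

@[simp] theorem counitHom_apply (x : HNCK K) : counitHom x = counit (R := K) x := rfl

@[simp] theorem counit_B (x : HNCK K) : counit (R := K) (B x) = 0 := by
  have h : (counit (R := K) (A := HNCK K)).comp B = 0 := by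
    refine (basisY K).ext fun F => ?_
    simpa using counit_Y_cons F 1
  exact congrFun (congrArg DFunLike.coe h) x

theorem comul_B (x : HNCK K) :
    comul (R := K) (B x) = B x ⊗ₜ[K] 1 + B.lTensor (HNCK K) (comul x) := by
  have h : (comul (R := K) (A := HNCK K)).comp B =
      (TensorProduct.mk K (HNCK K) (HNCK K)).flip 1 ∘ₗ B + B.lTensor (HNCK K) ∘ₗ comul := by
    refine (basisY K).ext fun F => ?_
    have := coprodY_cons (K := K) F 1
    rw [coprodY_one, mul_one] at this
    simpa [comul_Y] using this
  exact congrFun (congrArg DFunLike.coe h) x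

/-- Two algebra morphisms on `HNCK` agree if their agreement propagates along `B₊`. -/
theorem algHom_ext_B {A : Type*} [Ring A] [Algebra K A] (f g : HNCK K →ₐ[K] A)
    (h : ∀ x, f x = g x → f (B x) = g (B x)) (x : HNCK K) : f x = g x := by
  have hY : ∀ F, f (Y F) = g (Y F) := by
    intro F
    induction F with
    | empty => exact (map_one f).trans (map_one g).symm
    | cons F G h1 h2 => rw [Y_cons, map_mul, map_mul, h2, h _ h1]
  have : f.toLinearMap = g.toLinearMap := (basisY K).ext hY
  exact congrFun (congrArg DFunLike.coe this) x

theorem comul_coassoc (x : HNCK K) :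
    TensorProduct.assoc K (HNCK K) (HNCK K) (HNCK K) (comul.rTensor (HNCK K) (comul x)) =
      comul.lTensor (HNCK K) (comul x) := by
  let f : HNCK K →ₐ[K] HNCK K ⊗[K] (HNCK K ⊗[K] HNCK K) :=
    ((Algebra.TensorProduct.assoc K K K (HNCK K) (HNCK K) (HNCK K)).toAlgHom.comp
      (Algebra.TensorProduct.map comulHom (AlgHom.id K (HNCK K)))).comp comulHom
  let g : HNCK K →ₐ[K] HNCK K ⊗[K] (HNCK K ⊗[K] HNCK K) :=
    (Algebra.TensorProduct.map (AlgHom.id K (HNCK K)) comulHom).comp comulHom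
  have hf : ∀ x, f x = TensorProduct.assoc K (HNCK K) (HNCK K) (HNCK K)
    (comul.rTensor (HNCK K) (comul x)) := fun x => rfl
  have hg : ∀ x, g x = comul.lTensor (HNCK K) (comul x) := fun x => rfl
  rw [← hf, ← hg]
  refine algHom_ext_B f g (fun x hx => ?_) x
  rw [hf, hg] at hx ⊢
  have h1 : ∀ t : HNCK K ⊗[K] HNCK K,
      TensorProduct.assoc K (HNCK K) (HNCK K) (HNCK K)
        (comul.rTensor (HNCK K) (B.lTensor (HNCK K) t)) =
      (B.lTensor (HNCK K)).lTensor (HNCK K) (TensorProduct.assoc K (HNCK K) (HNCK K) (HNCK K)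
        (comul.rTensor (HNCK K) t)) := by
    intro t
    induction t with
    | zero => simp
    | add a b ha hb => simp only [map_add, ha, hb]
    | tmul a b =>
      simp only [LinearMap.lTensor_tmul, LinearMap.rTensor_tmul]
      generalize comul (R := K) a = s
      induction s with
      | zero => simp
      | add a b ha hb => simp only [TensorProduct.add_tmul, map_add, ha, hb]
      | tmul c d => simp
  have h2 : ∀ t : HNCK K ⊗[K] HNCK K,
      comul.lTensor (HNCK K) (B.lTensor (HNCK K) t) =
      TensorProduct.assoc K (HNCK K) (HNCK K) (HNCK K) (B.lTensor (HNCK K) t ⊗ₜ[K] 1) +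
      (B.lTensor (HNCK K)).lTensor (HNCK K) (comul.lTensor (HNCK K) t) := by
    intro t
    induction t with
    | zero => simp
    | add a b ha hb =>
      simp only [TensorProduct.add_tmul, map_add, ha, hb]; abel
    | tmul a b => simp [comul_B, TensorProduct.tmul_add]
  rw [comul_B]
  simp only [map_add, h1, h2, LinearMap.rTensor_tmul, LinearMap.lTensor_tmul, comul_B, hx,
    TensorProduct.add_tmul]
  have h3 : comul (R := K) (1 : HNCK K) = 1 ⊗ₜ[K] 1 := map_one (comulHom (K := K))
  simp [h3, add_assoc]

noncomputable instance : Coalgebra K (HNCK K) where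
  coassoc := LinearMap.ext comul_coassoc
  rTensor_counit_comp_comul := by
    refine LinearMap.ext fun x => ?_
    refine algHom_ext_B
      ((Algebra.TensorProduct.map counitHom (AlgHom.id K (HNCK K))).comp comulHom)
      Algebra.TensorProduct.includeRight (fun x hx => ?_) x
    change counit.rTensor (HNCK K) (comul x) = 1 ⊗ₜ[K] x at hx
    change counit.rTensor (HNCK K) (comul (B x)) = 1 ⊗ₜ[K] B x
    have h1 : ∀ t : HNCK K ⊗[K] HNCK K,
        (counit (R := K)).rTensor (HNCK K) (B.lTensor (HNCK K) t) =
          B.lTensor K (counit.rTensor (HNCK K) t) := by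
      intro t
      induction t with
      | zero => simp
      | add a b ha hb => simp only [map_add, ha, hb]
      | tmul a b => simp
    rw [comul_B, map_add, h1, hx]
    simp
  lTensor_counit_comp_comul := by
    refine LinearMap.ext fun x => ?_
    refine algHom_ext_B
      ((Algebra.TensorProduct.map (AlgHom.id K (HNCK K)) counitHom).comp comulHom)
      Algebra.TensorProduct.includeLeft (fun x _ => ?_) x
    change counit.lTensor (HNCK K) (comul (B x)) = B x ⊗ₜ[K] 1
    have h1 : ∀ t : HNCK K ⊗[K] HNCK K,
        (counit (R := K)).lTensor (HNCK K) (B.lTensor (HNCK K) t) = 0 := by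
      intro t
      induction t with
      | zero => simp
      | add a b ha hb => simp only [map_add, ha, hb, add_zero]
      | tmul a b => simp
    rw [comul_B, map_add, h1, add_zero, LinearMap.lTensor_tmul, ← Y_one, counit_Y_one]

end HNCK

/-- The dual `H*_NCK` with the product dual to the coproduct,
`(f * g)(Y_F) = ∑_{u ∈ C(F) ∩ [2]^n} f(Y_{F_(1)}) g(Y_{F_(2)})`.  An element `f` is the (possibly
infinite) combination `∑_F f(Y_F) X_F`, where `X_F` is the dual basis of `Y_F`. -/
abbrev HNCKDual (K : Type*) [CommRing K] := WithConv (HNCK K →ₗ[K] K)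

/-- The algebra `Sym` of noncommutative symmetric functions: the free associative algebra on
generators `S_1, S_2, …`. -/
abbrev NSym (K : Type*) [CommRing K] := MonoidAlgebra K (FreeMonoid ℕ+)

namespace NSym

variable (K : Type*) [CommRing K]

/-- The complete functions `S_n` (`S_0 = 1`). -/
noncomputable def S (n : ℕ) : NSym K :=
  if h : 0 < n then MonoidAlgebra.of K (FreeMonoid ℕ+) (FreeMonoid.of ⟨n, h⟩) else 1

/-- The elementary functions `Λ_n`, defined by
`(∑_n (-1)^n Λ_n) (∑_n S_n) = 1`, i.e. `λ_{-t}(A) σ_t(A) = 1`. -/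
noncomputable def Lam : ℕ → NSym K
  | 0 => 1
  | n + 1 => ∑ k : Fin (n + 1), (-1) ^ (k : ℕ) * (Lam (n - k) * S K (k + 1))

variable {K}

/-- For a family `g = S` or `g = Λ` and a composition `I = (i_1, …, i_r)`, the product
`g^I = g_{i_1} ⋯ g_{i_r}`. -/
noncomputable def multi (g : ℕ → NSym K) (I : List ℕ+) : NSym K := (I.map fun i : ℕ+ => g i).prod

/-- The morphism of `Sym` into `H*_NCK` which sends `S_n` to `∑_{|F| = n} X_F`. -/
noncomputable def embed : NSym K →ₐ[K] HNCKDual K :=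
  MonoidAlgebra.lift K (HNCKDual K) (FreeMonoid ℕ+) <| FreeMonoid.lift fun n =>
    WithConv.toConv ((HNCK.basisY K).constr K fun F => if F.size = (n : ℕ) then (1 : K) else 0)

/-- The pairing `⟨Y_F, x⟩` of `Y_F` with an element of `Sym`, seen in `H*_NCK`: the
coefficient of `X_F` in `x`. -/
noncomputable def pair (F : PlaneForest) (x : NSym K) : K :=
  (embed (K := K) x).ofConv (HNCK.Y F)

end NSym

section Alphabet

variable {R : Type*} [Semiring R]

/-- The series `∑_n g_n x_i^n` in the commuting variables `x_0, x_1, …`. -/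
noncomputable def genSeries (g : ℕ → R) (i : ℕ) : MvPowerSeries ℕ R :=
  fun m => if m = Finsupp.single i (m i) then g (m i) else 0

/-- The infinite ordered product `f_0 f_1 f_2 ⋯` of the series `f_i = ∑_n g_n x_i^n` with
`g_0 = 1`.  The coefficient of a monomial `m` is taken in the product of the `f_i` up to the last
variable of `m`, because the other factors do not contribute to it. -/
noncomputable def orderedProd (g : ℕ → R) : MvPowerSeries ℕ R :=
  fun m => MvPowerSeries.coeff m ((List.range (m.support.sup id + 1)).map (genSeries g)).prod

/-- The coefficients of `orderedProd` are the stationary values of those of the finite products. -/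
theorem coeff_orderedProd (g : ℕ → R) (h0 : g 0 = 1) (m : ℕ →₀ ℕ) (N : ℕ)
    (hN : m.support.sup id < N) :
    MvPowerSeries.coeff m ((List.range N).map (genSeries g)).prod =
      MvPowerSeries.coeff m (orderedProd g) := by
  classical
  induction N, hN using Nat.le_induction with
  | base => rfl
  | succ N hN ih =>
    rw [← ih, List.range_succ, List.map_append, List.prod_append, MvPowerSeries.coeff_mul,
      Finset.sum_eq_single (m, 0)]
    · simp [MvPowerSeries.coeff_apply, genSeries, h0]
    · rintro ⟨a, b⟩ hab hne
      rw [Finset.HasAntidiagonal.mem_antidiagonal] at hab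
      have hmN : m N = 0 := by
        by_contra h
        have : N ≤ m.support.sup id := Finset.le_sup (f := id) (Finsupp.mem_support_iff.2 h)
        omega
      have hbN : b N = 0 := by
        have : (a + b) N = m N := by rw [hab]
        simp only [Finsupp.add_apply] at this
        omega
      have hb : b ≠ 0 := by
        rintro rfl
        exact hne (by simpa using hab)
      have : MvPowerSeries.coeff b (genSeries g N) = 0 := by
        simp [MvPowerSeries.coeff_apply, genSeries, hbN, hb]
      simp [this]
    · intro h
      simp at h

end Alphabet

namespace NSym

variable (K : Type*) [CommRing K]

/-- `σ_1(XA) = ∏_{x ∈ X} σ_x(A)` (ordered product), `σ_x(A) = ∑_n x^n S_n`, for the ordered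
alphabet `X = {x_0 < x_1 < ⋯}` of commuting variables. -/
noncomputable def sigmaXA : MvPowerSeries ℕ (NSym K) := orderedProd (S K)

/-- `λ_1(XA) = ∏_{x ∈ X} λ_x(A)` (ordered product), `λ_x(A) = ∑_n x^n Λ_n`. -/
noncomputable def lambdaXA : MvPowerSeries ℕ (NSym K) := orderedProd (Lam K)

variable {K}

/-- The coefficient of `X_F` in (the image in `H*_NCK` of) a series in the variables `X` with
coefficients in `Sym`: a series in `X`. -/
noncomputable def coeffX (F : PlaneForest) (f : MvPowerSeries ℕ (NSym K)) : MvPowerSeries ℕ K :=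
  fun m => (MvPowerSeries.coeff m (MvPowerSeries.map (embed (K := K)).toRingHom f)).ofConv
    (HNCK.Y F)

end NSym

namespace QSym

variable (K : Type*) [CommRing K]

/-- The monomial quasi-symmetric function `M_I(X)`, the sum of all the monomials
`x_{j_1}^{i_1} ⋯ x_{j_r}^{i_r}` with `j_1 < ⋯ < j_r`. -/
noncomputable def M (I : List ℕ+) : MvPowerSeries ℕ K :=
  fun m => if (m.support.sort (· ≤ ·)).map m = I.map (fun i : ℕ+ => (i : ℕ)) then 1 else 0

/-- The monomial `x_0^{i_1} ⋯ x_{r-1}^{i_r}`. -/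
theorem exists_monomial (I : List ℕ+) :
    ∃ m : ℕ →₀ ℕ, (m.support.sort (· ≤ ·)).map m = I.map (fun i : ℕ+ => (i : ℕ)) := by
  refine ⟨(I.map (fun i : ℕ+ => (i : ℕ))).toFinsupp, ?_⟩
  have hs : (I.map (fun i : ℕ+ => (i : ℕ))).toFinsupp.support = Finset.range I.length := by
    ext k
    simp only [Finsupp.mem_support_iff, List.toFinsupp_apply, Finset.mem_range]
    by_cases hk : k < I.length
    · simp [hk]
    · simp [hk]
  rw [hs, Finset.sort_range]
  refine List.ext_getElem (by simp) fun k h1 h2 => ?_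
  simp only [List.length_map] at h2
  simp [h2]

theorem linearIndependent_M : LinearIndependent K (M K) := by
  classical
  rw [linearIndependent_iff]
  intro l hl
  ext I
  obtain ⟨m, hm⟩ := exists_monomial I
  have h := congrArg (MvPowerSeries.coeff m) hl
  rw [Finsupp.linearCombination_apply, Finsupp.sum, map_sum] at h
  have hc : ∀ J, MvPowerSeries.coeff m (l J • M K J) = if J = I then l J else 0 := by
    intro J
    rw [map_smul, MvPowerSeries.coeff_apply, M, hm, smul_eq_mul, mul_ite, mul_one, mul_zero]
    refine if_congr ?_ rfl rfl
    rw [(List.map_injective_iff.2 PNat.coe_injective).eq_iff, eq_comm]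
  simp only [hc, Finset.sum_ite_eq', map_zero] at h
  by_cases hI : I ∈ l.support
  · simpa [hI] using h
  · simpa using hI

end QSym

/-- The module of quasi-symmetric functions, spanned by the `M_I(X)`. -/
noncomputable def QSym (K : Type*) [CommRing K] : Submodule K (MvPowerSeries ℕ K) :=
  Submodule.span K (Set.range (QSym.M K))

namespace QSym

variable (K : Type*) [CommRing K]

/-- The basis `M_I` of `QSym`. -/
noncomputable def basisM : Module.Basis (List ℕ+) K (QSym K) :=
  Module.Basis.span (linearIndependent_M K)

/-- The compositions `J ≤ I`, i.e. those obtained from `I` by adding up groups of consecutive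
parts, each listed once. -/
def coarsenings : List ℕ+ → List (List ℕ+)
  | [] => [[]]
  | [a] => [[a]]
  | a :: b :: I => (coarsenings (b :: I)).map (a :: ·) ++ coarsenings ((a + b) :: I)
termination_by I => I.length

/-- The involution `f(X) ↦ f(-X)` of `QSym`, with
`M_I(-X) = (-1)^{ℓ(I)} ∑_{J ≤ I} M_J(X)`. -/
noncomputable def neg : QSym K →ₗ[K] QSym K :=
  (basisM K).constr K fun I =>
    (-1 : K) ^ I.length • ((coarsenings I).map fun J => basisM K J).sum

end QSym

namespace PlaneForest

open Classical in
/-- The linear extensions of `F`: the permutations `σ` with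
`i <_F j ⇒ σ⁻¹(i) < σ⁻¹(j)`. -/
noncomputable def linearExtensions (F : PlaneForest) : Finset (Equiv.Perm (Fin F.size)) :=
  Finset.univ.filter fun σ => ∀ i j, F.IsBelow i j → σ⁻¹ i < σ⁻¹ j

end PlaneForest

namespace FQSym

variable (K : Type*) [CommRing K]

/-- The standardization of a word of length `n` over the ordered alphabet `A = {a_0 < a_1 < ⋯}`:
letters are numbered in increasing order, equal letters from left to right. -/
def std {n : ℕ} (w : Fin n → ℕ) : Equiv.Perm (Fin n) := (Tuple.sort w)⁻¹

/-- The basis element `F_σ(A)` of `FQSym`, the formal sum of the words `w` with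
`std(w) = σ⁻¹`.  A formal sum of words of length `n` is given by its coefficients. -/
def basisF {n : ℕ} (σ : Equiv.Perm (Fin n)) : (Fin n → ℕ) → K :=
  fun w => if std w = σ⁻¹ then 1 else 0

variable {K}

/-- The commutative image `A → X` of a formal sum of words. -/
noncomputable def commImage {n : ℕ} (f : (Fin n → ℕ) → K) : MvPowerSeries ℕ K :=
  fun m => ∑ w ∈ (Fintype.piFinset fun _ : Fin n => m.support).filter
    (fun w => ∑ i, Finsupp.single (w i) 1 = m), f w

end FQSym

namespace PlaneForest

variable (K : Type*) [CommRing K]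

/-- The free generating function `Γ_F(A) = ∑_{σ ∈ L(F)} F_σ`. -/
noncomputable def freeGamma (F : PlaneForest) : (Fin F.size → ℕ) → K :=
  ∑ σ ∈ F.linearExtensions, FQSym.basisF K σ

/-- The quasi-symmetric function `Γ_F(X)`, the commutative image of `Γ_F(A)`. -/
noncomputable def gamma (F : PlaneForest) : MvPowerSeries ℕ K := FQSym.commImage (F.freeGamma K)

end PlaneForest

/-!
The coefficient of a monomial `m` in an ordered product `∏ ∑_n x^n g_n` is `g^I`, where `I` lists
the nonzero exponents of `m` (`coeff_orderedProd_eq_prod`), and `M_J` has the coefficient `1` or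
`0` at `m` according to whether `J = I`. So both generating series are the sums
`∑_I ⟨Y_F, g^I⟩ M_I`, which are finite because the pairing vanishes unless `I` is a
composition of `|F|`.

*The complete functions.* In the dual algebra `∑_n x^n S_n` is the character `Y_F ↦ x^{|F|}` of
`HNCK`. The product of these characters over `x_0, …, x_{N-1}` is again a character, since its
values lie in a commutative ring, and the cocycle property of `B₊` shows how it acts on `B₊`: the
root of `B₊(F)` receives the largest letter `c`, and `F` a word in the letters up to `c`
(`HNCK.wordChar_B`). By induction on the forest, its value on `Y_F` is the sum of the monomials
`x^w` of the words `w` that are weakly increasing along `<_F` (`HNCK.wordChar_Y`). These words are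
those whose standardization is the inverse of a linear extension
(`PlaneForest.std_inv_mem_linearExtensions`), so the sum is `Γ_F(X)`. No description of iterated
restrictions of forests is needed.

*The elementary functions.* As a power series has the same left and right inverse, `Λ_{n+1}` is also
the alternating sum of the `S_{k+1} Λ_{n-k}` (`NSym.Lam_succ_left`). Reading off the first part of
`J`, one finds the same recursion for the number of times `I` is a coarsening of `J`
(`QSym.count_coarsenings_cons`). Hence `Λ^I = ∑_J (-1)^{|I| - ℓ(J)} S^J`, where `J` runs over the
refinements of `I` (`NSym.multi_Lam_eq_sum`); after pairing with `Y_F` this is the transpose of the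
definition of `f(X) ↦ f(-X)` in the basis `M_I`, up to the factor `(-1)^{|F|}`.
-/

/-! ### Words compatible with a forest -/

namespace PlaneForest

open Classical in
/-- The words `w` in the letters `0, …, N - 1` with `i <_F j ⇒ w_i ≤ w_j`. -/
noncomputable def words (F : PlaneForest) (N : ℕ) : Finset (Fin F.size → ℕ) :=
  (Fintype.piFinset fun _ => Finset.range N).filter fun w => ∀ i j, F.IsBelow i j → w i ≤ w j

theorem mem_words {F : PlaneForest} {N : ℕ} {w : Fin F.size → ℕ} :
    w ∈ F.words N ↔ (∀ i, w i < N) ∧ ∀ i j, F.IsBelow i j → w i ≤ w j := by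
  simp [words, Fintype.mem_piFinset]

theorem glue_mem_words {N : ℕ} (F G : PlaneForest)
    (x : ((Fin F.size → ℕ) × ℕ) × (Fin G.size → ℕ)) :
    glue F G x ∈ (cons F G).words N ↔
      (x.1.2 < N ∧ x.1.1 ∈ F.words (x.1.2 + 1)) ∧ x.2 ∈ G.words N := by
  simp only [mem_words]
  constructor
  · rintro ⟨hN, h⟩
    have hr : x.1.2 < N := by simpa using hN (root F G)
    refine ⟨⟨hr, fun i => ?_, fun i j hij => ?_⟩, fun i => ?_, fun i j hij => ?_⟩
    · simpa [Nat.lt_succ_iff] using h (inSub F G i) (root F G) (Or.inr (Or.inl ⟨i, rfl, rfl⟩))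
    · simpa using h (inSub F G i) (inSub F G j) (Or.inl ⟨i, j, hij, rfl, rfl⟩)
    · simpa using hN (inRest F G i)
    · simpa using h (inRest F G i) (inRest F G j) (Or.inr (Or.inr ⟨i, j, hij, rfl, rfl⟩))
  · rintro ⟨⟨hr, h2, h1⟩, h4, h3⟩
    refine ⟨fun k => ?_, ?_⟩
    · change Fin (F.size + 1 + G.size) at k
      induction k using Fin.addCases with
      | left k =>
        induction k using Fin.lastCases with
        | last => exact (glue_root F G x).trans_lt hr
        | cast k =>
          refine (glue_inSub F G x k).trans_lt ?_
          have := h2 k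
          omega
      | right k => exact (glue_inRest F G x k).trans_lt (h4 k)
    · rintro i j (⟨a, b, h, rfl, rfl⟩ | ⟨a, rfl, rfl⟩ | ⟨a, b, h, rfl, rfl⟩)
      · simpa using h1 a b h
      · simpa [Nat.lt_succ_iff] using h2 a
      · simpa using h3 a b h

/-- Postorder is a linear extension of the forest order. -/
theorem lt_of_isBelow {F : PlaneForest} {i j : Fin F.size} (h : F.IsBelow i j) : i < j := by
  induction F with
  | empty => exact h.elim
  | cons F G hF hG =>
    rcases h with ⟨a, b, h, rfl, rfl⟩ | ⟨a, rfl, rfl⟩ | ⟨a, b, h, rfl, rfl⟩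
    · exact hF h
    · exact a.2
    · exact Nat.add_lt_add_left (hG h) (F.size + 1)

variable (K : Type*) [CommRing K]

/-- The polynomial `∑_w x^w` of the words `w` in `F.words N`. -/
noncomputable def wordSum (F : PlaneForest) (N : ℕ) : MvPowerSeries ℕ K :=
  ∑ w ∈ F.words N, ∏ i, MvPowerSeries.X (w i)

theorem wordSum_one (N : ℕ) : wordSum K 1 N = 1 := by
  change ∑ w ∈ (empty).words N, _ = _
  have : Unique (Fin empty.size → ℕ) := inferInstanceAs (Unique (Fin 0 → ℕ))
  have h : (empty).words N = Finset.univ := by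
    ext w
    simp only [mem_words, Finset.mem_univ, iff_true]
    exact ⟨fun i => i.elim0, fun i => i.elim0⟩
  rw [h, Fintype.sum_unique]
  exact Fin.prod_univ_zero _

theorem prod_glue {R : Type*} [CommMonoid R] (F G : PlaneForest) (f : ℕ → R)
    (x : ((Fin F.size → ℕ) × ℕ) × (Fin G.size → ℕ)) :
    ∏ i, f (glue F G x i) = (f x.1.2 * ∏ i, f (x.1.1 i)) * ∏ i, f (x.2 i) := by
  change ∏ i : Fin (F.size + 1 + G.size), f (glue F G x i) = _
  rw [Fin.prod_univ_add, Fin.prod_univ_castSucc, mul_comm (f x.1.2)]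
  refine congrArg₂ _ (congrArg₂ _ ?_ ?_) ?_
  · exact Finset.prod_congr rfl fun i _ => congrArg f (glue_inSub F G x i)
  · exact congrArg f (glue_root F G x)
  · exact Finset.prod_congr rfl fun i _ => congrArg f (glue_inRest F G x i)

theorem wordSum_cons (F G : PlaneForest) (N : ℕ) :
    wordSum K (cons F G) N =
      (∑ c ∈ Finset.range N, MvPowerSeries.X c * wordSum K F (c + 1)) * wordSum K G N := by
  have h1 : wordSum K (cons F G) N =
      ∑ x ∈ ((Finset.range N).sigma fun c => F.words (c + 1)) ×ˢ G.words N,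
        (MvPowerSeries.X x.1.1 * ∏ i, MvPowerSeries.X (x.1.2 i)) *
          ∏ i, (MvPowerSeries.X (x.2 i) : MvPowerSeries ℕ K) := by
    symm
    refine Finset.sum_bij (fun x _ => glue F G ((x.1.2, x.1.1), x.2)) ?_ ?_ ?_ ?_
    · intro x hx
      rw [glue_mem_words]
      simpa using hx
    · rintro ⟨⟨a, b⟩, c⟩ _ ⟨⟨a', b'⟩, c'⟩ _ h
      have := (glue_bijective F G).1 h
      simp only [Prod.mk.injEq] at this
      obtain ⟨⟨rfl, rfl⟩, rfl⟩ := this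
      rfl
    · intro u hu
      obtain ⟨x, rfl⟩ := (glue_bijective F G).2 u
      rw [glue_mem_words] at hu
      exact ⟨(⟨x.1.2, x.1.1⟩, x.2), by simpa using hu, rfl⟩
    · intro x _
      exact (prod_glue F G (fun c => (MvPowerSeries.X c : MvPowerSeries ℕ K))
        ((x.1.2, x.1.1), x.2)).symm
  rw [h1, Finset.sum_product]
  simp only [wordSum, ← Finset.mul_sum, ← Finset.sum_mul]
  rw [Finset.sum_sigma]
  congr 1
  refine Finset.sum_congr rfl fun c _ => ?_
  rw [Finset.mul_sum]

/-- The commutative image of a word of length `n` is a monomial. -/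
theorem prod_X_eq_monomial {n : ℕ} (w : Fin n → ℕ) :
    (∏ i, MvPowerSeries.X (w i) : MvPowerSeries ℕ K) =
      MvPowerSeries.monomial (∑ i, Finsupp.single (w i) 1) 1 := by
  simp only [MvPowerSeries.X]
  rw [MvPowerSeries.prod_monomial]
  simp

open Classical in
theorem coeff_wordSum (F : PlaneForest) (N : ℕ) (m : ℕ →₀ ℕ) :
    MvPowerSeries.coeff m (wordSum K F N) =
      ∑ w ∈ F.words N, if m = ∑ i, Finsupp.single (w i) 1 then 1 else 0 := by
  simp only [wordSum, map_sum, prod_X_eq_monomial, MvPowerSeries.coeff_monomial]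

/-- A word is standardized to the inverse of a linear extension if and only if it is weakly
increasing along the forest order: equal letters are numbered from left to right, and descendants
precede their ancestors in postorder. -/
theorem std_inv_mem_linearExtensions (F : PlaneForest) (w : Fin F.size → ℕ) :
    (FQSym.std w)⁻¹ ∈ F.linearExtensions ↔ ∀ i j, F.IsBelow i j → w i ≤ w j := by
  simp only [linearExtensions, Finset.mem_filter, Finset.mem_univ, true_and, inv_inv]
  refine forall₂_congr fun i j => forall_congr' fun hij => ?_
  have hlt := lt_of_isBelow hij
  obtain ⟨a, rfl⟩ := (Tuple.sort w).surjective i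
  obtain ⟨b, rfl⟩ := (Tuple.sort w).surjective j
  simp only [FQSym.std, Equiv.Perm.inv_def, Equiv.symm_apply_apply]
  obtain ⟨hmono, hstab⟩ := Tuple.eq_sort_iff.1 (rfl : Tuple.sort w = Tuple.sort w)
  refine ⟨fun h => hmono h.le, fun h => lt_of_not_ge fun hba => ?_⟩
  rcases hba.eq_or_lt with rfl | hba
  · exact lt_irrefl _ hlt
  · exact lt_asymm hlt (hstab b a hba (le_antisymm (hmono hba.le) h))

theorem coeff_gamma (F : PlaneForest) (m : ℕ →₀ ℕ) (N : ℕ) (hN : m.support ⊆ Finset.range N) :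
    MvPowerSeries.coeff m (F.gamma K) = MvPowerSeries.coeff m (wordSum K F N) := by
  classical
  have hfree : ∀ w, F.freeGamma K w = if ∀ i j, F.IsBelow i j → w i ≤ w j then 1 else 0 := by
    intro w
    rw [freeGamma, Finset.sum_apply]
    simp only [FQSym.basisF, ← std_inv_mem_linearExtensions, ← inv_eq_iff_eq_inv]
    rw [Finset.sum_ite_eq]
  rw [coeff_wordSum, MvPowerSeries.coeff_apply, gamma, FQSym.commImage]
  simp only [hfree]
  rw [← Finset.sum_filter, ← Finset.sum_filter]
  refine Finset.sum_congr ?_ fun _ _ => rfl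
  ext w
  simp only [Finset.mem_filter, Fintype.mem_piFinset, mem_words]
  constructor
  · rintro ⟨⟨h1, h2⟩, h3⟩
    exact ⟨⟨fun i => Finset.mem_range.1 (hN (h1 i)), h3⟩, h2.symm⟩
  · rintro ⟨⟨h1, h3⟩, rfl⟩
    refine ⟨⟨fun i => ?_, rfl⟩, h3⟩
    rw [Finsupp.mem_support_iff, Finsupp.finsetSum_apply]
    exact (Finset.sum_pos' (fun _ _ => Nat.zero_le _) ⟨i, Finset.mem_univ i, by simp⟩).ne'

/-- `∑_w x^w` is homogeneous of degree `|F|`. -/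
theorem coeff_wordSum_of_degree_ne (F : PlaneForest) (N : ℕ) (m : ℕ →₀ ℕ) (h : m.degree ≠ F.size) :
    MvPowerSeries.coeff m (wordSum K F N) = 0 := by
  classical
  rw [coeff_wordSum]
  refine Finset.sum_eq_zero fun w _ => if_neg ?_
  rintro rfl
  simp at h

end PlaneForest

/-! ### The character of the dual algebra in finitely many variables -/

namespace HNCK

open PlaneForest Coalgebra

variable {K : Type*} [CommRing K]

/-- The character `Y_F ↦ x^{|F|}` with values in a commutative algebra; it represents
`σ_x(A)` in the dual algebra. -/
noncomputable def sizeChar {R : Type*} [CommRing R] [Algebra K R] (x : R) : HNCK K →ₐ[K] R :=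
  AlgHom.ofLinearMap ((basisY K).constr K fun F => x ^ F.size)
    (by rw [← Y_one, Module.Basis.constr_basis]; exact pow_zero x) <| by
    intro a b
    have hsize : ∀ F G : PlaneForest, (F * G).size = F.size + G.size := by
      intro F G
      induction F with
      | empty => exact (zero_add _).symm
      | cons F F' _ ih =>
        change F.size + 1 + (F' * G).size = F.size + 1 + F'.size + G.size
        rw [ih, add_assoc (F.size + 1)]
    have h : (LinearMap.mul K (HNCK K)).compr₂ ((basisY K).constr K fun F => x ^ F.size) =
        (LinearMap.mul K R).compl₁₂ ((basisY K).constr K fun F => x ^ F.size)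
          ((basisY K).constr K fun F => x ^ F.size) := by
      refine (basisY K).ext fun F => (basisY K).ext fun G => ?_
      simp only [LinearMap.compr₂_apply, LinearMap.mul_apply', LinearMap.compl₁₂_apply]
      rw [Y_mul, Module.Basis.constr_basis, Module.Basis.constr_basis, Module.Basis.constr_basis,
        hsize, pow_add]
    exact congrFun (congrArg DFunLike.coe (congrFun (congrArg DFunLike.coe h) a)) b

theorem sizeChar_Y {R : Type*} [CommRing R] [Algebra K R] (x : R) (F : PlaneForest) :
    sizeChar x (Y F : HNCK K) = x ^ F.size :=
  (basisY K).constr_basis K _ F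

theorem sizeChar_B {R : Type*} [CommRing R] [Algebra K R] (x : R) (a : HNCK K) :
    sizeChar x (B a) = x * sizeChar x a := by
  have h : (sizeChar x).toLinearMap ∘ₗ B =
      LinearMap.mulLeft K x ∘ₗ (sizeChar (K := K) x).toLinearMap := by
    refine (basisY K).ext fun F => ?_
    simp only [LinearMap.comp_apply, AlgHom.toLinearMap_apply, LinearMap.mulLeft_apply]
    rw [B_Y, sizeChar_Y, sizeChar_Y, ← pow_succ']
    rfl
  exact congrFun (congrArg DFunLike.coe h) a

variable (K) in
/-- The convolution product of the characters `Y_F ↦ x_i^{|F|}` for `i = 0, …, N - 1`, in this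
order. -/
noncomputable def wordChar : ℕ → (HNCK K →ₐ[K] MvPowerSeries ℕ K)
  | 0 => (Algebra.ofId K _).comp counitHom
  | N + 1 => ((Algebra.TensorProduct.lmul' K).comp
      (Algebra.TensorProduct.map (wordChar N) (sizeChar (MvPowerSeries.X N)))).comp comulHom

theorem wordChar_succ_Y (N : ℕ) (F : PlaneForest) :
    wordChar K (N + 1) (Y F) = ∑ u ∈ F.labellings 2,
      wordChar K N (Y (F.part u 0)) * MvPowerSeries.X N ^ (F.part u 1).size := by
  simp only [wordChar, AlgHom.comp_apply, comulHom_apply]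
  rw [comul_Y, coprodY, map_sum, map_sum]
  refine Finset.sum_congr rfl fun u _ => ?_
  rw [Algebra.TensorProduct.map_tmul, Algebra.TensorProduct.lmul'_apply_tmul, sizeChar_Y]

/-- In each term `x_c` is the letter of the root of `B₊(F)`, the largest one. -/
theorem wordChar_B (N : ℕ) (a : HNCK K) :
    wordChar K N (B a) = ∑ c ∈ Finset.range N, MvPowerSeries.X c * wordChar K (c + 1) a := by
  induction N with
  | zero => simp [wordChar]
  | succ N ih =>
    rw [Finset.sum_range_succ, ← ih]
    have h : ∀ t : HNCK K ⊗[K] HNCK K,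
        Algebra.TensorProduct.lmul' K (Algebra.TensorProduct.map (wordChar K N)
          (sizeChar (MvPowerSeries.X N)) (B.lTensor (HNCK K) t)) =
        MvPowerSeries.X N * Algebra.TensorProduct.lmul' K (Algebra.TensorProduct.map (wordChar K N)
          (sizeChar (MvPowerSeries.X N)) t) := by
      intro t
      induction t with
      | zero => simp
      | add a b ha hb => simp only [map_add, ha, hb, mul_add]
      | tmul a b => simp [sizeChar_B, mul_left_comm]
    simp only [wordChar, AlgHom.comp_apply, comulHom_apply]
    rw [comul_B, map_add, map_add, h]
    simp

theorem wordChar_Y (F : PlaneForest) (N : ℕ) : wordChar K N (Y F) = wordSum K F N := by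
  induction F generalizing N with
  | empty => exact (map_one (wordChar K N)).trans (wordSum_one K N).symm
  | cons F G hF hG =>
    rw [Y_cons, map_mul, wordChar_B, hG, wordSum_cons]
    simp only [hF]

end HNCK

/-! ### Coefficients of `X_F` -/

namespace NSym

open PlaneForest

variable {K : Type*} [CommRing K]

/-- The pairing with `Y_F` as a linear form on `Sym`. -/
noncomputable def pairLin (F : PlaneForest) : NSym K →ₗ[K] K where
  toFun := pair F
  map_add' x y := by simp [pair]
  map_smul' c x := by simp [pair]

@[simp] theorem pairLin_apply (F : PlaneForest) (x : NSym K) : pairLin F x = pair F x := rfl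

theorem pair_mul (F : PlaneForest) (x y : NSym K) :
    pair F (x * y) = ∑ u ∈ F.labellings 2, pair (F.part u 0) x * pair (F.part u 1) y := by
  simp only [pair]
  rw [map_mul, LinearMap.convMul_def, WithConv.ofConv_toConv, LinearMap.comp_apply,
    LinearMap.comp_apply, HNCK.comul_Y, HNCK.coprodY, map_sum, map_sum]
  rfl

theorem pair_one (F : PlaneForest) : pair F (1 : NSym K) = if F.size = 0 then 1 else 0 := by
  rw [pair, map_one]
  change algebraMap K K (Coalgebra.counit (HNCK.Y F : HNCK K)) = _
  cases F with
  | empty =>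
    refine Eq.trans ?_ (if_pos rfl).symm
    exact HNCK.counit_Y_one
  | cons F G =>
    refine Eq.trans ?_ (if_neg (show F.size + 1 + G.size ≠ 0 by omega)).symm
    exact HNCK.counit_Y_cons F G

theorem pair_S (F : PlaneForest) (n : ℕ) : pair F (S K n) = if F.size = n then 1 else 0 := by
  rcases Nat.eq_zero_or_pos n with rfl | hn
  · rw [S, dif_neg (lt_irrefl 0), pair_one]
  · rw [S, dif_pos hn, pair, embed, MonoidAlgebra.of_apply, MonoidAlgebra.lift_single, one_smul]
    exact (HNCK.basisY K).constr_basis K _ F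

theorem coeff_coeffX (F : PlaneForest) (f : MvPowerSeries ℕ (NSym K)) (m : ℕ →₀ ℕ) :
    MvPowerSeries.coeff m (coeffX F f) = pair F (MvPowerSeries.coeff m f) := rfl

theorem coeffX_mul (F : PlaneForest) (f g : MvPowerSeries ℕ (NSym K)) :
    coeffX F (f * g) =
      ∑ u ∈ F.labellings 2, coeffX (F.part u 0) f * coeffX (F.part u 1) g := by
  classical
  ext m
  rw [coeff_coeffX, MvPowerSeries.coeff_mul, ← pairLin_apply, map_sum, map_sum]
  simp only [pairLin_apply, pair_mul, MvPowerSeries.coeff_mul, coeff_coeffX]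
  exact Finset.sum_comm

theorem coeffX_one (F : PlaneForest) :
    coeffX F (1 : MvPowerSeries ℕ (NSym K)) = HNCK.wordChar K 0 (HNCK.Y F) := by
  classical
  ext m
  rw [coeff_coeffX, MvPowerSeries.coeff_one, HNCK.wordChar, AlgHom.comp_apply,
    HNCK.counitHom_apply, Algebra.ofId_apply, MvPowerSeries.algebraMap_apply,
    MvPowerSeries.coeff_C]
  have h1 : pair F (1 : NSym K) = Coalgebra.counit (R := K) (HNCK.Y F : HNCK K) := by
    rw [pair, map_one]
    rfl
  split_ifs
  · rw [h1]
    rfl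
  · exact map_zero (pairLin F)

theorem coeffX_genSeries_S (F : PlaneForest) (i : ℕ) :
    coeffX F (genSeries (S K) i) = MvPowerSeries.X i ^ F.size := by
  classical
  ext m
  rw [coeff_coeffX, MvPowerSeries.coeff_X_pow, MvPowerSeries.coeff_apply, genSeries]
  by_cases hm : m = Finsupp.single i F.size
  · subst hm
    simp [pair_S]
  · rw [if_neg hm]
    split_ifs with h
    · rw [pair_S, if_neg]
      intro h'
      exact hm (by rw [h']; exact h)
    · exact map_zero (pairLin F)

theorem coeffX_prod_genSeries_S (F : PlaneForest) (N : ℕ) :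
    coeffX F ((List.range N).map (genSeries (S K))).prod = wordSum K F N := by
  rw [← HNCK.wordChar_Y]
  induction N generalizing F with
  | zero => exact coeffX_one F
  | succ N ih =>
    rw [List.range_succ, List.map_append, List.prod_append, coeffX_mul, HNCK.wordChar_succ_Y]
    refine Finset.sum_congr rfl fun u _ => ?_
    rw [ih, List.map_singleton, List.prod_singleton, coeffX_genSeries_S]

end NSym

/-! ### Monomials and compositions -/

section Alphabet

variable {R : Type*} [Semiring R]

theorem coeff_prod_genSeries (g : ℕ → R) (N : ℕ) (m : ℕ →₀ ℕ) :
    MvPowerSeries.coeff m ((List.range N).map (genSeries g)).prod =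
      if m.support ⊆ Finset.range N then ((List.range N).map fun i => g (m i)).prod else 0 := by
  classical
  induction N generalizing m with
  | zero => simp [MvPowerSeries.coeff_one]
  | succ N ih =>
    have hsub : (m.erase N).support ⊆ Finset.range N ↔ m.support ⊆ Finset.range (N + 1) := by
      rw [Finsupp.support_erase, Finset.range_add_one, Finset.subset_insert_iff]
    have hprod : ((List.range N).map fun i => g (m.erase N i)) =
        (List.range N).map fun i => g (m i) := by
      refine List.map_congr_left fun i hi => ?_
      rw [Finsupp.erase_ne (List.mem_range.1 hi).ne]
    rw [List.range_succ, List.map_append, List.prod_append, List.map_append, List.prod_append,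
      MvPowerSeries.coeff_mul, Finset.sum_eq_single (m.erase N, Finsupp.single N (m N))]
    · rw [ih, hprod]
      simp only [hsub, List.map_singleton, List.prod_singleton, MvPowerSeries.coeff_apply,
        genSeries, Finsupp.single_eq_same, if_true, ite_mul, zero_mul]
    · rintro ⟨a, b⟩ hab hne
      rw [Finset.HasAntidiagonal.mem_antidiagonal] at hab
      rw [ih, List.map_singleton, List.prod_singleton, MvPowerSeries.coeff_apply, genSeries]
      split_ifs with ha hb
      · refine absurd ?_ hne
        have haN : a N = 0 := by
          by_contra h
          exact absurd (ha (Finsupp.mem_support_iff.2 h)) (by simp)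
        have hmN : m N = b N := by rw [← hab, Finsupp.add_apply, haN, zero_add]
        rw [hmN, ← hb, Prod.mk.injEq]
        refine ⟨?_, rfl⟩
        rw [← hab, hb, Finsupp.erase_add, Finsupp.erase_single, add_zero,
          Finsupp.erase_of_notMem_support (by simpa using haN)]
      all_goals simp
    · intro h
      refine absurd ?_ h
      rw [Finset.HasAntidiagonal.mem_antidiagonal]
      exact Finsupp.erase_add_single N m

/-- The coefficient of a monomial in an infinite ordered product is the product of the `g_n` over
its nonzero exponents, in the order of the variables. -/
theorem coeff_orderedProd_eq_prod (g : ℕ → R) (h0 : g 0 = 1) (m : ℕ →₀ ℕ) :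
    MvPowerSeries.coeff m (orderedProd g) =
      (((m.support.sort (· ≤ ·)).map m).map g).prod := by
  have hsub : m.support ⊆ Finset.range (m.support.sup id + 1) := fun i hi =>
    Finset.mem_range.2 (Nat.lt_succ_of_le (Finset.le_sup (f := id) hi))
  have hsort : m.support.sort (· ≤ ·) =
      (List.range (m.support.sup id + 1)).filter fun i => m i ≠ 0 := by
    have hfin : m.support =
        ((List.range (m.support.sup id + 1)).filter fun i => m i ≠ 0).toFinset := by
      ext i
      simp only [List.mem_toFinset, List.mem_filter, List.mem_range, decide_eq_true_eq]
      exact ⟨fun h => ⟨Finset.mem_range.1 (hsub h), Finsupp.mem_support_iff.1 h⟩,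
        fun h => Finsupp.mem_support_iff.2 h.2⟩
    conv_lhs => rw [hfin]
    rw [List.toFinset_sort _ (List.nodup_range.filter _)]
    exact (List.pairwise_lt_range.imp le_of_lt).filter _
  have hfilter : ∀ l : List ℕ, (l.map fun i => g (m i)).prod =
      (((l.filter fun i => m i ≠ 0).map m).map g).prod := by
    intro l
    induction l with
    | nil => rfl
    | cons a l ih =>
      by_cases ha : m a = 0
      · simp [ha, h0, ih]
      · simp [ha, ih]
  rw [← coeff_orderedProd g h0 m _ (Nat.lt_succ_self _), coeff_prod_genSeries, if_pos hsub,
    hsort, hfilter]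

end Alphabet

namespace QSym

variable (K : Type*) [CommRing K]

/-- The list of the nonzero exponents of a monomial is a composition. -/
theorem exists_composition (m : ℕ →₀ ℕ) :
    ∃ I : List ℕ+, (m.support.sort (· ≤ ·)).map m = I.map (fun i : ℕ+ => (i : ℕ)) := by
  have h : ∀ l : List ℕ, (∀ x ∈ l, 0 < x) → ∃ I : List ℕ+, l = I.map (fun i : ℕ+ => (i : ℕ)) := by
    intro l hl
    lift l to List ℕ+ using hl
    exact ⟨l, rfl⟩
  refine h _ fun x hx => ?_
  obtain ⟨i, hi, rfl⟩ := List.mem_map.1 hx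
  exact Nat.pos_of_ne_zero (Finsupp.mem_support_iff.1 ((Finset.mem_sort _).1 hi))

variable {K} in
theorem coeff_M {m : ℕ →₀ ℕ} {I : List ℕ+}
    (hI : (m.support.sort (· ≤ ·)).map m = I.map (fun i : ℕ+ => (i : ℕ))) (J : List ℕ+) :
    MvPowerSeries.coeff m (M K J) = if J = I then 1 else 0 := by
  rw [MvPowerSeries.coeff_apply, M, hI]
  refine if_congr ?_ rfl rfl
  rw [(List.map_injective_iff.2 PNat.coe_injective).eq_iff, eq_comm]

theorem sum_eq_degree {m : ℕ →₀ ℕ} {I : List ℕ+}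
    (hI : (m.support.sort (· ≤ ·)).map m = I.map (fun i : ℕ+ => (i : ℕ))) :
    (I.map (fun i : ℕ+ => (i : ℕ))).sum = m.degree := by
  rw [← hI, Finsupp.degree_apply, ← Multiset.sum_coe, ← Multiset.map_coe, Finset.sort_eq]
  rfl

variable {K} in
theorem coeff_finsum_smul_M {c : List ℕ+ → K} (hc : (Function.support c).Finite) {m : ℕ →₀ ℕ}
    {I : List ℕ+} (hI : (m.support.sort (· ≤ ·)).map m = I.map (fun i : ℕ+ => (i : ℕ))) :
    MvPowerSeries.coeff m (∑ᶠ J, c J • M K J) = c I := by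
  classical
  have hs : (Function.support fun J => c J • M K J) ⊆ hc.toFinset := by
    intro J hJ
    rw [hc.coe_toFinset]
    intro h
    exact hJ (by simp [h])
  rw [finsum_eq_sum_of_support_subset _ hs, map_sum]
  simp only [map_smul, coeff_M hI, smul_eq_mul, mul_ite, mul_one, mul_zero]
  rw [Finset.sum_ite_eq']
  split_ifs with h
  · rfl
  · simpa [eq_comm] using h

end QSym

namespace NSym

open PlaneForest

variable {K : Type*} [CommRing K]

theorem coeffX_orderedProd (F : PlaneForest) {g : ℕ → NSym K} (h0 : g 0 = 1) {m : ℕ →₀ ℕ}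
    {I : List ℕ+} (hI : (m.support.sort (· ≤ ·)).map m = I.map (fun i : ℕ+ => (i : ℕ))) :
    MvPowerSeries.coeff m (coeffX F (orderedProd g)) = pair F (multi g I) := by
  rw [coeff_coeffX, coeff_orderedProd_eq_prod g h0, hI, List.map_map]
  rfl

theorem S_zero : S K 0 = 1 := dif_neg (lt_irrefl 0)

theorem Lam_zero : Lam K 0 = 1 := by rw [Lam]

theorem coeffX_sigmaXA (F : PlaneForest) : coeffX F (sigmaXA K) = F.gamma K := by
  ext m
  rw [coeff_gamma K F m (m.support.sup id + 1) fun i hi =>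
      Finset.mem_range.2 (Nat.lt_succ_of_le (Finset.le_sup (f := id) hi)),
    coeff_coeffX, sigmaXA, ← coeff_orderedProd _ S_zero m _ (Nat.lt_succ_self _),
    ← coeffX_prod_genSeries_S, coeff_coeffX]

theorem pair_multi_S_of_sum_ne (F : PlaneForest) (I : List ℕ+)
    (h : (I.map (fun i : ℕ+ => (i : ℕ))).sum ≠ F.size) : pair F (multi (S K) I) = 0 := by
  obtain ⟨m, hm⟩ := QSym.exists_monomial I
  rw [← coeffX_orderedProd F S_zero hm, ← sigmaXA, coeffX_sigmaXA,
    coeff_gamma K F m (m.support.sup id + 1) fun i hi =>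
      Finset.mem_range.2 (Nat.lt_succ_of_le (Finset.le_sup (f := id) hi))]
  exact coeff_wordSum_of_degree_ne K F _ m (by rwa [← QSym.sum_eq_degree hm])

end NSym

/-! ### Compositions and their coarsenings -/

/-- The compositions of `n`, listed by their first part. -/
def compositions : ℕ → Finset (List ℕ+)
  | 0 => {[]}
  | n + 1 => Finset.univ.biUnion fun k : Fin (n + 1) =>
      (compositions (n - k)).image (Nat.succPNat k :: ·)

theorem mem_compositions {n : ℕ} {I : List ℕ+} :
    I ∈ compositions n ↔ (I.map (fun i : ℕ+ => (i : ℕ))).sum = n := by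
  induction I generalizing n with
  | nil =>
    cases n with
    | zero => simp [compositions]
    | succ n => simp [compositions]
  | cons a I ih =>
    cases n with
    | zero => simp [compositions]
    | succ n =>
      simp only [compositions, Finset.mem_biUnion, Finset.mem_univ, true_and, Finset.mem_image,
        List.cons.injEq, List.map_cons, List.sum_cons]
      constructor
      · rintro ⟨k, J, hJ, rfl, rfl⟩
        rw [ih.1 hJ, Nat.succPNat_coe]
        omega
      · intro h
        have ha := a.pos
        refine ⟨⟨a - 1, by omega⟩, I, ih.2 ?_, PNat.eq ?_, rfl⟩
        · change _ = n - ((a : ℕ) - 1)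
          omega
        · change (a : ℕ) - 1 + 1 = a
          omega

theorem sum_compositions_succ {M : Type*} [AddCommMonoid M] (n : ℕ) (f : List ℕ+ → M) :
    ∑ J ∈ compositions (n + 1), f J =
      ∑ k ∈ Finset.range (n + 1), ∑ J ∈ compositions (n - k), f (Nat.succPNat k :: J) := by
  rw [compositions, Finset.sum_biUnion, Finset.sum_range]
  · refine Finset.sum_congr rfl fun k _ => ?_
    rw [Finset.sum_image fun _ _ _ _ h => List.tail_eq_of_cons_eq h]
  · intro k _ l _ hkl
    rw [Function.onFun, Finset.disjoint_left]
    intro J hJ hJ'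
    obtain ⟨J₁, -, rfl⟩ := Finset.mem_image.1 hJ
    obtain ⟨J₂, -, h⟩ := Finset.mem_image.1 hJ'
    exact hkl (Fin.ext (Nat.succPNat_injective (List.head_eq_of_cons_eq h)).symm)

namespace QSym

theorem sum_of_mem_coarsenings {I J : List ℕ+} (h : I ∈ coarsenings J) :
    (I.map (fun i : ℕ+ => (i : ℕ))).sum = (J.map (fun i : ℕ+ => (i : ℕ))).sum := by
  induction J using coarsenings.induct generalizing I with
  | case1 => simp_all [coarsenings]
  | case2 a => simp_all [coarsenings]
  | case3 a b J ih1 ih2 =>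
    rw [coarsenings, List.mem_append, List.mem_map] at h
    rcases h with ⟨I, hI, rfl⟩ | h
    · simp [ih1 hI]
    · simp [ih2 h, add_assoc]

theorem count_map_cons (i a : ℕ+) (I : List ℕ+) (L : List (List ℕ+)) :
    (L.map (a :: ·)).count (i :: I) = if a = i then L.count I else 0 := by
  split_ifs with h
  · subst h
    exact List.count_map_of_injective L _ List.cons_injective I
  · refine List.count_eq_zero_of_not_mem fun hm => ?_
    obtain ⟨J, -, hJ⟩ := List.mem_map.1 hm
    exact h (List.head_eq_of_cons_eq hJ)

/-- The multiplicity of `i :: I` among the coarsenings of `a :: J`: the part `a` either is the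
whole of the part `i`, or the first of several consecutive parts that add up to it. -/
theorem count_coarsenings_cons (i a : ℕ+) (I J : List ℕ+) :
    (coarsenings (a :: J)).count (i :: I) =
      (if a = i then (coarsenings J).count I else 0) +
        if a < i then (coarsenings J).count ((i - a) :: I) else 0 := by
  induction J generalizing i a with
  | nil =>
    rw [coarsenings, coarsenings]
    cases I <;> simp [List.count_singleton]
  | cons b J ih =>
    rw [coarsenings, List.count_append, count_map_cons, ih i (a + b)]
    congr 1
    by_cases ha : a < i
    · rw [if_pos ha, ih (i - a) b]
      have h1 : b = i - a ↔ a + b = i := by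
        rw [← PNat.coe_inj, ← PNat.coe_inj, PNat.sub_coe, if_pos ha, PNat.add_coe]
        have : (a : ℕ) < i := ha
        omega
      have h2 : b < i - a ↔ a + b < i := by
        rw [← PNat.coe_lt_coe, ← PNat.coe_lt_coe, PNat.sub_coe, if_pos ha, PNat.add_coe]
        have : (a : ℕ) < i := ha
        omega
      simp only [h1, h2]
      congr 1
      refine if_ctx_congr Iff.rfl (fun hab => ?_) fun _ => rfl
      congr 2
      apply PNat.eq
      -- subtraction in `ℕ+` truncates at `1`, so both differences are first seen to be proper
      have h3 : (a : ℕ) + b < i := hab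
      have h4 : b < i - a := h2.2 hab
      rw [PNat.sub_coe, if_pos hab, PNat.sub_coe, if_pos h4, PNat.sub_coe, if_pos ha, PNat.add_coe]
      omega
    · have h1 : ¬ a + b = i := fun h => ha (h ▸ PNat.lt_add_right a b)
      have h2 : ¬ a + b < i := fun h => ha ((PNat.lt_add_right a b).trans h)
      simp [ha, h1, h2]

end QSym

/-! ### Expansion of `Λ^I` in the basis `S^J` -/

namespace NSym

variable {K : Type*} [CommRing K]

/-- The recursion for `Λ_n` with the factor `S_k` on the left: the inverse of a power series
is two-sided. -/
theorem Lam_succ_left (n : ℕ) :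
    Lam K (n + 1) = ∑ k ∈ Finset.range (n + 1), (-1) ^ k * (S K (k + 1) * Lam K (n - k)) := by
  set L : PowerSeries (NSym K) := PowerSeries.mk fun n => (-1) ^ n * Lam K n
  set T : PowerSeries (NSym K) := PowerSeries.mk (S K)
  have hcomm : ∀ (k : ℕ) (x : NSym K), x * (-1) ^ k = (-1) ^ k * x := fun k x =>
    ((Commute.one_left x).neg_left.pow_left k).symm.eq
  have hLT : L * T = 1 := by
    refine PowerSeries.ext fun n => ?_
    rw [PowerSeries.coeff_mul, PowerSeries.coeff_one, Finset.Nat.sum_antidiagonal_eq_sum_range_succ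
      (fun a b => (PowerSeries.coeff a L * PowerSeries.coeff b T : NSym K))]
    simp only [L, T, PowerSeries.coeff_mk]
    cases n with
    | zero => simp [Lam_zero, S_zero]
    | succ n =>
      rw [if_neg n.succ_ne_zero, Finset.sum_range_succ, Nat.sub_self, S_zero, mul_one, Lam,
        Finset.sum_fin_eq_sum_range, Finset.mul_sum, ← Finset.sum_range_reflect,
        ← Finset.sum_add_distrib]
      refine Finset.sum_eq_zero fun k hk => ?_
      rw [Finset.mem_range] at hk
      obtain ⟨r, rfl⟩ : ∃ r, n = k + r := ⟨n - k, by omega⟩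
      rw [dif_pos hk, show k + r + 1 - 1 - k = r by omega, show k + r + 1 - r = k + 1 by omega,
        show k + r - k = r by omega, ← mul_assoc ((-1) ^ (k + r + 1)), ← pow_add,
        show k + r + 1 + k = r + 1 + (k + k) by ring, pow_add _ (r + 1), Even.neg_one_pow ⟨k, rfl⟩,
        mul_one, pow_succ, mul_assoc]
      simp
  have hTL : T * L = 1 := by
    have hT : PowerSeries.constantCoeff T = ((1 : (NSym K)ˣ) : NSym K) := by
      rw [← PowerSeries.coeff_zero_eq_constantCoeff_apply, PowerSeries.coeff_mk, S_zero]
      rfl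
    have h := PowerSeries.mul_invOfUnit T 1 hT
    rwa [← left_inv_eq_right_inv hLT h] at h
  have hn := congrArg (PowerSeries.coeff (n + 1)) hTL
  rw [PowerSeries.coeff_mul, PowerSeries.coeff_one, if_neg n.succ_ne_zero,
    Finset.Nat.sum_antidiagonal_eq_sum_range_succ
      (fun a b => (PowerSeries.coeff a T * PowerSeries.coeff b L : NSym K)),
    Finset.sum_range_succ'] at hn
  simp only [L, T, PowerSeries.coeff_mk, S_zero, one_mul, Nat.sub_zero] at hn
  have h2 := congrArg (fun x => (-1) ^ n * x) hn
  simp only [mul_add, mul_zero, ← mul_assoc, ← pow_add] at h2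
  rw [show n + (n + 1) = n + n + 1 by ring, pow_succ, Even.neg_one_pow ⟨n, rfl⟩, one_mul, neg_mul,
    one_mul, add_neg_eq_zero] at h2
  rw [← h2, Finset.mul_sum]
  refine Finset.sum_congr rfl fun k hk => ?_
  rw [Finset.mem_range] at hk
  obtain ⟨r, rfl⟩ : ∃ r, n = k + r := ⟨n - k, by omega⟩
  rw [show k + r + 1 - (k + 1) = r by omega, show k + r - k = r by omega,
    hcomm r, ← mul_assoc, ← mul_assoc, ← pow_add, add_assoc, pow_add, Even.neg_one_pow ⟨r, rfl⟩,
    mul_one, mul_assoc]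

theorem multi_cons (g : ℕ → NSym K) (i : ℕ+) (I : List ℕ+) :
    multi g (i :: I) = g i * multi g I := by
  simp [multi]

/-- `Λ^I` is the sum of the `(-1)^{|I| - ℓ(J)} S^J` over the refinements `J` of `I`. -/
theorem multi_Lam_eq_sum (n : ℕ) (I : List ℕ+)
    (hI : (I.map (fun i : ℕ+ => (i : ℕ))).sum = n) :
    multi (Lam K) I = ∑ J ∈ compositions n,
      ((-1 : K) ^ (n + J.length) * ((QSym.coarsenings J).count I : K)) • multi (S K) J := by
  induction n using Nat.strong_induction_on generalizing I with
  | _ n IH =>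
  cases I with
  | nil =>
    obtain rfl : n = 0 := hI.symm
    simp [compositions, QSym.coarsenings, multi]
  | cons i I =>
    rw [List.map_cons, List.sum_cons] at hI
    obtain ⟨p, rfl⟩ : ∃ p, i = Nat.succPNat p := ⟨i.natPred, (PNat.succPNat_natPred i).symm⟩
    obtain ⟨q, rfl⟩ : ∃ q, n = p + q + 1 := by
      rw [Nat.succPNat_coe] at hI
      exact ⟨n - (p + 1), by omega⟩
    have hIq : (I.map (fun i : ℕ+ => (i : ℕ))).sum = q := by
      rw [Nat.succPNat_coe] at hI
      omega
    rw [multi_cons, Nat.succPNat_coe, Nat.succ_eq_add_one, Lam_succ_left, Finset.sum_mul,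
      sum_compositions_succ,
      -- parts `k + 1` of `J` that exceed the first part `p + 1` of `I` do not contribute
      ← Finset.sum_subset (Finset.range_subset_range.2 (show p + 1 ≤ p + q + 1 by omega))]
    · refine Finset.sum_congr rfl fun k hk => ?_
      -- a common form for `k < p`, with `I' = (p - k) :: I`, and for `k = p`, with `I' = I`
      have hterm : ∀ (I' : List ℕ+) (r : ℕ), p + q = k + r →
          (I'.map (fun i : ℕ+ => (i : ℕ))).sum = r →
          (∀ J, (QSym.coarsenings (k.succPNat :: J)).count (p.succPNat :: I) =
            (QSym.coarsenings J).count I') →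
          ∑ J ∈ compositions (p + q - k), ((-1 : K) ^ (p + q + 1 + (k.succPNat :: J).length) *
            ((QSym.coarsenings (k.succPNat :: J)).count (p.succPNat :: I) : K)) •
              multi (S K) (k.succPNat :: J) =
          (-1) ^ k * (S K (k + 1) * multi (Lam K) I') := by
        intro I' r hr hI' hcount
        rw [IH r (by omega) I' hI', Finset.mul_sum, Finset.mul_sum, show p + q - k = r by omega]
        refine Finset.sum_congr rfl fun J _ => ?_
        rw [hcount, multi_cons, Nat.succPNat_coe, Nat.succ_eq_add_one, mul_smul_comm, hr,
          List.length_cons, show k + r + 1 + (J.length + 1) = k + (r + J.length) + (1 + 1) by ring,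
          pow_add, pow_add, Even.neg_one_pow ⟨1, rfl⟩, mul_one, mul_assoc, mul_smul]
        rcases Nat.even_or_odd k with h | h <;> simp [h.neg_one_pow]
      rw [Finset.mem_range] at hk
      rcases (Nat.lt_succ_iff.1 hk).eq_or_lt with rfl | hkp
      · rw [hterm I q rfl hIq fun J => by rw [QSym.count_coarsenings_cons]; simp, Nat.sub_self,
          Lam_zero, mul_one, mul_assoc]
      · obtain ⟨d, rfl⟩ : ∃ d, p = k + d + 1 := ⟨p - k - 1, by omega⟩
        have hne : ¬ k.succPNat = (k + d + 1).succPNat := fun h => by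
          have := Nat.succPNat_injective h
          omega
        have hlt : k.succPNat < (k + d + 1).succPNat := Nat.succPNat_lt_succPNat.2 hkp
        have hsub : (k + d + 1).succPNat - k.succPNat = d.succPNat := by
          apply PNat.eq
          rw [PNat.sub_coe, if_pos hlt]
          simp only [Nat.succPNat_coe]
          omega
        rw [hterm (d.succPNat :: I) (d + 1 + q) (by ring) (by simp [hIq]) fun J => by
            rw [QSym.count_coarsenings_cons, if_neg hne, if_pos hlt, hsub, zero_add],
          multi_cons, Nat.succPNat_coe, Nat.succ_eq_add_one,
          show k + d + 1 - k = d + 1 by omega]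
        simp only [mul_assoc]
    · intro k _ hk
      rw [Finset.mem_range, not_lt] at hk
      refine Finset.sum_eq_zero fun J _ => ?_
      have h1 : ¬ k.succPNat = p.succPNat := fun h => by
        have := Nat.succPNat_injective h
        omega
      have h2 : ¬ k.succPNat < p.succPNat := fun h => by
        have := Nat.succPNat_lt_succPNat.1 h
        omega
      rw [QSym.count_coarsenings_cons, if_neg h1, if_neg h2]
      simp

end NSym

namespace NSym

open PlaneForest

variable {K : Type*} [CommRing K]

theorem pair_multi_Lam (F : PlaneForest) (I : List ℕ+) :
    pair F (multi (Lam K) I) = ∑ J ∈ compositions F.size,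
      ((-1 : K) ^ (F.size + J.length) * ((QSym.coarsenings J).count I : K)) *
        pair F (multi (S K) J) := by
  have h := congrArg (pairLin F) (multi_Lam_eq_sum (K := K) _ I rfl)
  simp only [map_sum, map_smul, pairLin_apply, smul_eq_mul] at h
  by_cases hI : (I.map (fun i : ℕ+ => (i : ℕ))).sum = F.size
  · rw [h, hI]
  · rw [h, Finset.sum_eq_zero fun J hJ => ?_, Finset.sum_eq_zero fun J hJ => ?_]
    · rw [List.count_eq_zero_of_not_mem fun hm => hI ?_, Nat.cast_zero, mul_zero, zero_mul]
      rw [QSym.sum_of_mem_coarsenings hm, mem_compositions.1 hJ]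
    · rw [pair_multi_S_of_sum_ne F J (by rwa [mem_compositions.1 hJ]), mul_zero]

theorem finite_support_of_eq_zero_of_sum_ne {n : ℕ} {c : List ℕ+ → K}
    (hc : ∀ I, (I.map (fun i : ℕ+ => (i : ℕ))).sum ≠ n → c I = 0) :
    (Function.support c).Finite :=
  (compositions n).finite_toSet.subset fun I hI =>
    Finset.mem_coe.2 (mem_compositions.2 (not_not.1 fun h => hI (hc I h)))

theorem pair_multi_Lam_of_sum_ne (F : PlaneForest) (I : List ℕ+)
    (h : (I.map (fun i : ℕ+ => (i : ℕ))).sum ≠ F.size) : pair F (multi (Lam K) I) = 0 := by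
  rw [pair_multi_Lam]
  refine Finset.sum_eq_zero fun J hJ => ?_
  rw [List.count_eq_zero_of_not_mem fun hm => h ?_, Nat.cast_zero, mul_zero, zero_mul]
  rw [QSym.sum_of_mem_coarsenings hm, mem_compositions.1 hJ]

theorem coeffX_orderedProd_eq_finsum (F : PlaneForest) {g : ℕ → NSym K} (h0 : g 0 = 1)
    (hg : (Function.support fun I : List ℕ+ => pair F (multi g I)).Finite) :
    coeffX F (orderedProd g) = ∑ᶠ I : List ℕ+, pair F (multi g I) • QSym.M K I := by
  ext m
  obtain ⟨I, hI⟩ := QSym.exists_composition m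
  rw [coeffX_orderedProd F h0 hI, QSym.coeff_finsum_smul_M hg hI]

end NSym

/-! ### The involution `f(X) ↦ f(-X)` and the coefficients of `Γ_F(X)` -/

namespace QSym

variable {K : Type*} [CommRing K]

theorem coe_basisM (I : List ℕ+) : (basisM K I : MvPowerSeries ℕ K) = M K I :=
  congrArg Subtype.val (Module.Basis.span_apply (linearIndependent_M K) I)

theorem coeff_neg_basisM {m : ℕ →₀ ℕ} {I : List ℕ+}
    (hI : (m.support.sort (· ≤ ·)).map m = I.map (fun i : ℕ+ => (i : ℕ))) (J : List ℕ+) :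
    MvPowerSeries.coeff m (neg K (basisM K J) : MvPowerSeries ℕ K) =
      (-1) ^ J.length * ((coarsenings J).count I : K) := by
  have h : ∀ L : List (List ℕ+), MvPowerSeries.coeff m
      ((L.map fun J => basisM K J).sum : MvPowerSeries ℕ K) = (L.count I : K) := by
    intro L
    induction L with
    | nil => simp
    | cons J L ih =>
      rw [List.map_cons, List.sum_cons, Submodule.coe_add, map_add, ih, coe_basisM, coeff_M hI,
        List.count_cons]
      by_cases hJ : J = I <;> simp [hJ, add_comm]
  rw [neg, Module.Basis.constr_basis, Submodule.coe_smul, map_smul, h, smul_eq_mul]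

end QSym

open NSym in
theorem mainTheorem5 {K : Type*} [CommRing K] (F : PlaneForest) :
    ((Function.support fun I : List ℕ+ => pair F (multi (S K) I)).Finite ∧
      coeffX F (sigmaXA K) = ∑ᶠ I : List ℕ+, pair F (multi (S K) I) • QSym.M K I ∧
      ∑ᶠ I : List ℕ+, pair F (multi (S K) I) • QSym.M K I = F.gamma K) ∧
    ((Function.support fun I : List ℕ+ => pair F (multi (Lam K) I)).Finite ∧
      coeffX F (lambdaXA K) = ∑ᶠ I : List ℕ+, pair F (multi (Lam K) I) • QSym.M K I ∧
      ∃ h : F.gamma K ∈ QSym K,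
        ∑ᶠ I : List ℕ+, pair F (multi (Lam K) I) • QSym.M K I =
          (-1 : K) ^ F.size • (QSym.neg K ⟨F.gamma K, h⟩ : MvPowerSeries ℕ K)) := by
  have hS := finite_support_of_eq_zero_of_sum_ne (pair_multi_S_of_sum_ne (K := K) F)
  have hL := finite_support_of_eq_zero_of_sum_ne (pair_multi_Lam_of_sum_ne (K := K) F)
  have h1 := coeffX_orderedProd_eq_finsum F S_zero hS
  have h2 := coeffX_orderedProd_eq_finsum F Lam_zero hL
  have h3 : ∑ᶠ I : List ℕ+, pair F (multi (S K) I) • QSym.M K I = F.gamma K := by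
    rw [← h1]
    exact coeffX_sigmaXA F
  have hγ : F.gamma K = ((∑ J ∈ compositions F.size, pair F (multi (S K) J) • QSym.basisM K J :
      QSym K) : MvPowerSeries ℕ K) := by
    rw [← h3, finsum_eq_sum_of_support_subset (s := compositions F.size)]
    · simp only [Submodule.coe_sum, Submodule.coe_smul, QSym.coe_basisM]
    · intro I hI
      rw [Finset.mem_coe, mem_compositions]
      by_contra h
      exact hI (by simp only [pair_multi_S_of_sum_ne F I h, zero_smul])
  have hmem : F.gamma K ∈ QSym K := by
    rw [hγ]
    exact Submodule.coe_mem _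
  refine ⟨⟨hS, h1, h3⟩, hL, h2, hmem, ?_⟩
  have hsub : (⟨F.gamma K, hmem⟩ : QSym K) =
      ∑ J ∈ compositions F.size, pair F (multi (S K) J) • QSym.basisM K J := Subtype.ext hγ
  ext m
  obtain ⟨I, hI⟩ := QSym.exists_composition m
  rw [QSym.coeff_finsum_smul_M hL hI, pair_multi_Lam, hsub, map_sum, Submodule.coe_sum,
    map_smul, map_sum, Finset.smul_sum]
  refine Finset.sum_congr rfl fun J _ => ?_
  rw [map_smul, Submodule.coe_smul, map_smul, QSym.coeff_neg_basisM hI, smul_eq_mul, smul_eq_mul]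
  ring
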